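/- Let $(p,p-2)$ be a pair of twin primes, i.e. $p$ and $p-2$ are both prime numbers, and let $E_p$ be the elliptic curve over $\mathbb{Q}$ given by $$E_p:\ y^2=x(x-2)(x-p).$$ Then the Mordell–Weil rank of $E_p$, that is, the rank of the abelian group $E_p(\mathbb{Q})$ of $\mathbb{Q}$-rational points of $E_p$, is at most two. -/

import Mathlib

/-- The curve `E_p : y² = x (x - 2) (x - p) = x³ - (p + 2) x² + 2 p x` over `ℚ`. -/
def twinPrimeCurve (p : ℕ) : WeierstrassCurve ℚ where
  a₁ := 0
  a₂ := -((p : ℚ) + 2)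
  a₃ := 0
  a₄ := 2 * (p : ℚ)
  a₆ := 0

theorem twinPrimeCurve_equation_iff (p : ℕ) (x y : ℚ) :
    (twinPrimeCurve p).toAffine.Equation x y ↔ y ^ 2 = x * (x - 2) * (x - (p : ℚ)) := by
  rw [WeierstrassCurve.Affine.equation_iff]
  simp only [twinPrimeCurve]
  constructor <;> intro h <;> linarith

theorem twinPrimeCurve_discr (p : ℕ) :
    (twinPrimeCurve p).Δ = 64 * (p : ℚ) ^ 2 * ((p : ℚ) - 2) ^ 2 := by
  simp only [twinPrimeCurve, WeierstrassCurve.Δ, WeierstrassCurve.b₂, WeierstrassCurve.b₄,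
    WeierstrassCurve.b₆, WeierstrassCurve.b₈]
  ring

/-- For a twin prime pair `(p, p - 2)` the curve `E_p` is nonsingular. -/
theorem twinPrimeCurve_isElliptic {p : ℕ} (hp : p.Prime) (hp' : (p - 2).Prime) :
    (twinPrimeCurve p).IsElliptic := by
  refine ⟨?_⟩
  rw [twinPrimeCurve_discr, isUnit_iff_ne_zero]
  have h0 : (p : ℚ) ≠ 0 := by exact_mod_cast hp.ne_zero
  have h2 : (p : ℚ) - 2 ≠ 0 := by
    have hne : p ≠ 2 := by
      rintro rfl
      exact Nat.not_prime_zero hp'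
    rw [sub_ne_zero]
    exact_mod_cast hne
  positivity

/-- The Mordell–Weil rank of a Weierstrass curve `E` over `ℚ`: the rank of the abelian group
`E(ℚ)` of its rational points (including the point at infinity), that is, the supremum of the
cardinalities of its `ℤ`-linearly independent subsets. It is a cardinal, so that a bound on it
carries no convention about groups of infinite rank. -/
noncomputable def mordellWeilRank (E : WeierstrassCurve ℚ) : Cardinal :=
  Module.rank ℤ E.toAffine.Point

/-! A finitely generated group `A` of rank `r` has `[A : 2A] = 2 ^ r * #A[2]`. Since `E_p` has four
rational 2-torsion points, it suffices to bound `[E_p(ℚ) : 2E_p(ℚ)]` by 16.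

This is a complete 2-descent. Modulo squares, `P ↦ (x, x - 2)` (corrected at the roots) is a
homomorphism with kernel `2E_p(ℚ)`. As the roots 0, 2, `p` differ by 2, `p` and `p - 2`, the
valuations of `x` are even away from 2 and `p`, and those of `x - 2` away from 2 and `p - 2`.
Moreover `x` contributes no sign, and the parities of `x` and `x - 2` at 2 agree because `x - p` has
even valuation there. Four bits remain (`exists_add_self_eq_sub_of_descentClass_eq`).

Finite generation is proved rather than assumed: the finite index feeds a descent by the naive
height, which satisfies an approximate parallelogram law and the Northcott property. -/

/-! ### Rank and index of `2A` in an abelian group. -/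

theorem Module.rank_int_eq_of_equiv_prod_finite {A T : Type*} [AddCommGroup A] [AddCommGroup T]
    [Finite T] {n : ℕ} (f : A ≃+ (Fin n →₀ ℤ) × T) : Module.rank ℤ A = n := by
  let g : A →ₗ[ℤ] (Fin n →₀ ℤ) := LinearMap.fst ℤ _ _ ∘ₗ f.toIntLinearEquiv.toLinearMap
  have hg : Function.Surjective g := fun v ↦ ⟨f.symm (v, 0), by simp [g]⟩
  have hker : Module.rank ℤ (LinearMap.ker g) = 0 := by
    rw [rank_eq_zero_iff]
    rintro ⟨x, hx⟩
    obtain ⟨m, hm, hmx⟩ := (isOfFinAddOrder_of_finite (f x).2).exists_nsmul_eq_zero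
    refine ⟨m, by positivity, Subtype.ext (f.injective ?_)⟩
    have hx1 : (f x).1 = 0 := hx
    simp only [natCast_zsmul, SetLike.mk_smul_mk, ZeroMemClass.coe_zero, map_zero, map_nsmul]
    exact Prod.ext (by simp [hx1]) (by simpa using hmx)
  have h := LinearMap.lift_rank_eq_of_surjective hg
  rw [hker, Cardinal.lift_zero, add_zero, Cardinal.lift_id'.{0}] at h
  simpa using h

theorem AddSubgroup.index_range_two_nsmul_prod (n : ℕ) (T : Type*) [AddCommGroup T] [Finite T] :
    (nsmulAddMonoidHom (α := (Fin n →₀ ℤ) × T) 2).range.index =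
      2 ^ n * Nat.card (nsmulAddMonoidHom (α := (Fin n →₀ ℤ) × T) 2).ker := by
  have hr : (nsmulAddMonoidHom (α := (Fin n →₀ ℤ) × T) 2).range =
      (nsmulAddMonoidHom (α := Fin n →₀ ℤ) 2).range.prod (nsmulAddMonoidHom (α := T) 2).range := by
    ext ⟨v, t⟩
    simp [AddSubgroup.mem_prod, Prod.ext_iff]
  have hk : Nat.card (nsmulAddMonoidHom (α := (Fin n →₀ ℤ) × T) 2).ker =
      Nat.card (nsmulAddMonoidHom (α := T) 2).ker := by
    have hk' : (nsmulAddMonoidHom (α := (Fin n →₀ ℤ) × T) 2).ker =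
        (⊥ : AddSubgroup (Fin n →₀ ℤ)).prod (nsmulAddMonoidHom (α := T) 2).ker := by
      ext ⟨v, t⟩
      simp [AddSubgroup.mem_prod, Prod.ext_iff, AddMonoidHom.mem_ker]
    rw [hk', Nat.card_congr (AddSubgroup.prodEquiv _ _).toEquiv]
    simp
  rw [hr, hk, AddSubgroup.index_prod, AddSubgroup.index_range_nsmul, AddSubgroup.index_range]
  simp

/-- In a finitely generated abelian group `A` one has `[A : 2A] = 2 ^ n * #A[2]`, where `n` is the
rank of `A`. -/
theorem AddCommGroup.exists_rank_eq_and_index_range_two_nsmul (A : Type*) [AddCommGroup A]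
    [AddGroup.FG A] : ∃ n : ℕ, Module.rank ℤ A = n ∧
      (nsmulAddMonoidHom (α := A) 2).range.index =
        2 ^ n * Nat.card (nsmulAddMonoidHom (α := A) 2).ker := by
  obtain ⟨n, ι, _, p, hp, e, ⟨f⟩⟩ := AddCommGroup.equiv_free_prod_directSum_zmod A
  have : ∀ i, NeZero (p i ^ e i) := fun i ↦ ⟨pow_ne_zero _ (hp i).ne_zero⟩
  have : Finite (DirectSum ι fun i ↦ ZMod (p i ^ e i)) :=
    Finite.of_injective (fun x i ↦ x i) DFunLike.coe_injective
  refine ⟨n, Module.rank_int_eq_of_equiv_prod_finite f, ?_⟩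
  have h := AddSubgroup.index_range_two_nsmul_prod n (DirectSum ι fun i ↦ ZMod (p i ^ e i))
  have hr : (nsmulAddMonoidHom
      (α := (Fin n →₀ ℤ) × DirectSum ι fun i ↦ ZMod (p i ^ e i)) 2).range.index =
      (nsmulAddMonoidHom (α := A) 2).range.index := by
    rw [← AddSubgroup.index_map_equiv _ f]
    simp [AddEquiv.map_range_nsmulAddMonoidHom]
  have hk : Nat.card (nsmulAddMonoidHom (α := A) 2).ker = Nat.card
      (nsmulAddMonoidHom (α := (Fin n →₀ ℤ) × DirectSum ι fun i ↦ ZMod (p i ^ e i)) 2).ker :=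
    Nat.card_congr <| f.toEquiv.subtypeEquiv fun a ↦ by
      simp [AddMonoidHom.mem_ker, ← map_nsmul]
  rw [← hr, hk, h]

theorem AddCommGroup.rank_le_two_of_index_le {A : Type*} [AddCommGroup A]
    [AddGroup.FG A] (h0 : (nsmulAddMonoidHom (α := A) 2).range.index ≠ 0)
    (hi : (nsmulAddMonoidHom (α := A) 2).range.index ≤ 16) (t : Fin 4 → A)
    (ht : Function.Injective t) (ht2 : ∀ i, t i + t i = 0) : Module.rank ℤ A ≤ 2 := by
  obtain ⟨n, hn, h⟩ := AddCommGroup.exists_rank_eq_and_index_range_two_nsmul A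
  -- `Nat.card` of an infinite kernel would be 0, and so would the index.
  have : Finite (nsmulAddMonoidHom (α := A) 2).ker :=
    (Nat.card_ne_zero.mp fun hc ↦ h0 (by rw [h, hc, mul_zero])).2
  have hk : 4 ≤ Nat.card (nsmulAddMonoidHom (α := A) 2).ker := by
    simpa using Nat.card_le_card_of_injective
      (fun i ↦ (⟨t i, by simp [AddMonoidHom.mem_ker, two_nsmul, ht2]⟩ :
        (nsmulAddMonoidHom (α := A) 2).ker)) fun i j hij ↦ ht (congrArg Subtype.val hij)
  have h4 : 2 ^ n ≤ 2 ^ 2 := by nlinarith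
  rw [hn]
  exact_mod_cast (Nat.pow_le_pow_iff_right one_lt_two).mp h4

/-! ### Naive heights and finite generation. -/

open WeierstrassCurve WeierstrassCurve.Affine Height

namespace WeierstrassCurve.Affine.Point

variable {F : Type*} [Field F] [DecidableEq F] {W : Affine F}

theorem exists_addSubMap_sym2x_self [W.IsCharNeTwoNF] [W.IsElliptic]
    (P : W.Point) : ∃ c : F, c ≠ 0 ∧
      (fun i ↦ (addSubMap W i).eval (P.sym2x P)) = c • (P + P).sym2x 0 := by
  cases P with
  | zero =>
    refine ⟨1, one_ne_zero, ?_⟩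
    ext i
    fin_cases i <;> simp [addSubMap, ← zero_def]
  | some x y h =>
    have hE := (equation_iff _ _).mp h.1
    have hn := addSubMap_ne_zero W (sym2x_ne_zero (some x y h) (some x y h))
    by_cases hy : y = W.negY x y
    · rw [add_self_of_Y_eq hy, sym2x_zero_zero]
      have hv : (fun i ↦ (addSubMap W i).eval ((some x y h).sym2x (some x y h))) =
          (addSubMap W 0).eval ((some x y h).sym2x (some x y h)) • ![1, 0, 0] := by
        simp [negY] at hy hE
        ext i
        fin_cases i 
        · simp
        · simp [addSubMap, b₂, b₄, b₆]
          linear_combination (-4) * hE + 2 * y * hy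
        · simp [addSubMap]; ring
      refine ⟨_, fun h0 ↦ hn ?_, hv⟩
      rw [hv, h0, zero_smul]
    · rw [add_self_of_Y_ne hy, sym2x_some_zero, sym2x_some_some]
      have hsl := slope_of_Y_ne rfl hy
      set ℓ := W.slope x x y y
      simp [negY] at hy hE hsl
      have hy2 : y + y ≠ 0 := fun h0 ↦ hy (by linear_combination h0)
      rw [eq_div_iff (by simpa using hy2)] at hsl
      refine ⟨(y + y) ^ 2, pow_ne_zero _ hy2, ?_⟩
      ext i
      fin_cases i
      · simp [addSubMap, b₂, b₄, b₆, b₈, addX]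
        grind
      · simp [addSubMap, b₂, b₄, b₆]
        linear_combination (-4) * hE
      · simp [addSubMap]; ring

/-- The quadratic forms `addSubMap` compute the pair `x(P + Q)`, `x(P - Q)` projectively from
`x(P)`, `x(Q)`; the scalar `c` does not affect heights. -/
theorem exists_addSubMap_sym2x [W.IsCharNeTwoNF] [W.IsElliptic]
    (P Q : W.Point) : ∃ c : F, c ≠ 0 ∧
      (fun i ↦ (addSubMap W i).eval (P.sym2x Q)) = c • (P + Q).sym2x (P - Q) := by
  by_cases hPQ : P = Q
  · subst hPQ
    simpa using exists_addSubMap_sym2x_self P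
  by_cases hPQ' : P = -Q
  · subst hPQ'
    obtain ⟨c, hc, h⟩ := exists_addSubMap_sym2x_self (-Q)
    refine ⟨c, hc, ?_⟩
    rw [sym2x_neg_right] at h
    rw [h, neg_add_cancel, sym2x_comm 0, sub_eq_add_neg]
  match P, Q with
  | 0, 0 => exact absurd rfl hPQ
  | 0, some x y h | some x y h, 0 =>
    refine ⟨1, one_ne_zero, ?_⟩
    ext i
    fin_cases i <;> simp [addSubMap, sym2x] <;> ring
  | some x y h, some x' y' h' =>
    have hx : x ≠ x' := fun hx ↦ (X_eq_iff.mp hx).elim hPQ hPQ'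
    have hE := (equation_iff _ _).mp h.1
    have hE' := (equation_iff _ _).mp h'.1
    rw [sub_eq_add_neg, neg_some, add_of_X_ne hx, add_of_X_ne hx, sym2x_some_some,
      sym2x_some_some, slope_of_X_ne hx, slope_of_X_ne hx]
    have hd : x - x' ≠ 0 := sub_ne_zero.mpr hx
    obtain ⟨ℓ, hℓ⟩ : ∃ ℓ, ℓ = (y - y') / (x - x') := ⟨_, rfl⟩
    obtain ⟨m, hm⟩ : ∃ m, m = (y - W.negY x' y') / (x - x') := ⟨_, rfl⟩
    rw [← hℓ, ← hm]
    rw [eq_div_iff hd] at hℓ hm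
    simp [negY] at hE hE' hm
    -- The chords through `P` and `±Q` have slopes `ℓ` and `m`; `(y - y')(y + y')` is a difference
    -- of values of the cubic, hence divisible by `x - x'`.
    have hlm : ℓ * m * (x - x') = x ^ 2 + x * x' + x' ^ 2 + W.a₂ * (x + x') + W.a₄ := by
      apply mul_right_cancel₀ hd
      linear_combination hE - hE' + ℓ * (x - x') * hm + (y + y') * hℓ
    refine ⟨(x - x') ^ 2, pow_ne_zero _ hd, ?_⟩
    ext i
    fin_cases i
    · simp [addSubMap, b₂, b₄, b₆, b₈, addX]
      linear_combination
        -(ℓ * m * (x - x') + (x ^ 2 + x * x' + x' ^ 2 + W.a₂ * (x + x') + W.a₄)) * hlm +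
        (W.a₂ + x + x') * ((ℓ * (x - x') + y - y') * hℓ + (m * (x - x') + y + y') * hm +
          2 * hE + 2 * hE')
    · simp [addSubMap, b₂, b₄, b₆, addX]
      grind
    · simp [addSubMap]; ring

end WeierstrassCurve.Affine.Point

namespace WeierstrassCurve.Affine.Point

variable {K : Type*} [Field K] [AdmissibleAbsValues K] {W : Affine K}

/-- The naive height of a point on a Weierstrass curve. -/
noncomputable def naiveHeight (P : W.Point) : ℝ := logHeight P.xRep

theorem naiveHeight_nonneg (P : W.Point) : 0 ≤ naiveHeight P := logHeight_nonneg _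

theorem exists_abs_logHeight_sym2x_sub_le (W : Affine K) : ∃ C, ∀ P Q : W.Point,
    |logHeight (P.sym2x Q) - (naiveHeight P + naiveHeight Q)| ≤ C := by
  obtain ⟨C, hC⟩ := abs_logHeight_sym2_sub_le K
  have hx (P : W.Point) : P.xRep = ![P.xRep 0, P.xRep 1] := by
    ext i; fin_cases i <;> rfl
  refine ⟨C, fun P Q ↦ ?_⟩
  have h := hC (a := P.xRep 0) (b := P.xRep 1) (c := Q.xRep 0) (d := Q.xRep 1)
    (hx P ▸ xRep_ne_zero P) (hx Q ▸ xRep_ne_zero Q)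
  rwa [← hx, ← hx] at h

/-- The approximate parallelogram law for the naive height. -/
theorem exists_abs_naiveHeight_add_sub_le [DecidableEq K] (W : Affine K)
    [W.IsCharNeTwoNF] [W.IsElliptic] :
    ∃ C, ∀ P Q : W.Point,
      |naiveHeight (P + Q) + naiveHeight (P - Q) - 2 * (naiveHeight P + naiveHeight Q)| ≤ C := by
  obtain ⟨C₁, h₁⟩ := exists_abs_logHeight_sym2x_sub_le W
  obtain ⟨C₂, h₂⟩ := abs_logHeight_addSubMap_sub_two_mul_logHeight_le W
  -- `C₁` enters once for `(P + Q, P - Q)` and twice for `(P, Q)`, as `addSubMap` has degree two.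
  refine ⟨3 * C₁ + C₂, fun P Q ↦ ?_⟩
  obtain ⟨c, hc, h⟩ := exists_addSubMap_sym2x P Q
  have hPQ := h₂ (P.sym2x Q)
  rw [h, logHeight_smul_eq_logHeight _ hc] at hPQ
  have ha := abs_le.mp (h₁ P Q)
  have hb := abs_le.mp (h₁ (P + Q) (P - Q))
  have hd := abs_le.mp hPQ
  exact abs_le.mpr ⟨by linarith, by linarith⟩

instance northcott_naiveHeight [Northcott (logHeight₁ (K := K))] :
    Northcott (naiveHeight (W := W)) where
  finite_le B := by
    have hfin : ((fun x : K ↦ ![x, 1]) '' {x | logHeight₁ x ≤ B} ∪ {![1, 0]}).Finite :=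
      ((Northcott.finite_le B).image _).union (Set.finite_singleton _)
    refine Set.Finite.of_finite_fibers xRep (hfin.subset ?_) fun v _ ↦ ?_
    · rintro _ ⟨P, hP, rfl⟩
      cases P with
      | zero => exact .inr rfl
      | some x y h =>
        refine .inl ⟨x, ?_, rfl⟩
        rwa [Set.mem_ofPred_eq, logHeight₁_eq_logHeight]
    · by_cases hv : ∃ P : W.Point, P.xRep = v
      · obtain ⟨P, rfl⟩ := hv
        exact (Set.toFinite {P, -P}).subset fun Q hQ ↦ eq_or_eq_neg_of_xRep_eq_xRep hQ.2
      · exact (Set.finite_empty).subset fun Q hQ ↦ hv ⟨Q, hQ.2⟩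

/-- The weak Mordell-Weil theorem for multiplication by two implies the Mordell-Weil theorem. -/
theorem fg_of_finiteIndex_range_two_nsmul [DecidableEq K]
    [Northcott (logHeight₁ (K := K))] (W : Affine K) [W.IsCharNeTwoNF] [W.IsElliptic]
    (h : (nsmulAddMonoidHom (α := W.Point) 2).range.FiniteIndex) : AddGroup.FG W.Point :=
  AddCommGroup.fg_of_descent' h naiveHeight_nonneg (exists_abs_naiveHeight_add_sub_le W).choose_spec

end WeierstrassCurve.Affine.Point

/-! ### The 2-descent map and its kernel. -/

namespace WeierstrassCurve.Affine.Point

variable {F : Type*} [Field F] {W : Affine F}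

theorem y_eq_zero_of_x_eq [W.IsCharNeTwoNF] {e y : F} (he : W.Equation e 0)
    (h : W.Equation e y) : y = 0 := by
  rw [equation_iff] at he h
  simp at he h
  rw [← sq_eq_zero_iff, h, ← he]

variable [DecidableEq F]

/-- The component at the root `e` of the descent map of `y² = x³ + a₂x² + a₄x + a₆`, as a map to
`F` (whose values matter modulo squares): it sends `(x, y)` to `x - e` if `x ≠ e`, and to the
derivative of the right hand side at `e` otherwise. -/
def descentMap (e : F) : W.Point → F
  | 0 => 1
  | some x _ _ => if x = e then 3 * e ^ 2 + 2 * W.a₂ * e + W.a₄ else x - e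

@[simp]
theorem descentMap_zero (e : F) : descentMap e (0 : W.Point) = 1 := rfl

theorem descentMap_some_of_ne {e x y : F} (h : W.Nonsingular x y) (hx : x ≠ e) :
    descentMap e (some x y h) = x - e := if_neg hx

theorem descentMap_some_self {e y : F} (h : W.Nonsingular e y) :
    descentMap e (some e y h) = 3 * e ^ 2 + 2 * W.a₂ * e + W.a₄ := if_pos rfl

@[simp]
theorem descentMap_neg (e : F) (P : W.Point) : descentMap e (-P) = descentMap e P := by
  cases P <;> rfl

variable [W.IsCharNeTwoNF]

theorem descentMap_ne_zero {e : F} (he : W.Nonsingular e 0) (P : W.Point) :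
    descentMap e P ≠ 0 := by
  cases P with
  | zero => exact one_ne_zero
  | some x y h =>
    by_cases hx : x = e
    · subst hx
      rw [descentMap_some_self]
      have := ((nonsingular_iff _ _).mp he).2
      simp at this
      exact fun h ↦ this h.symm
    · rw [descentMap_some_of_ne h hx]
      exact sub_ne_zero.mpr hx

/-- Translation by `T = (e, 0)` satisfies `(x(T + P) - e)(x(P) - e) = f'(e)`, where `f` is the
cubic, so the product is `f'(e)²`. -/
theorem isSquare_descentMap_mul_root {e : F} (he : W.Nonsingular e 0) {x y : F}
    (h : W.Nonsingular x y) (hx : x ≠ e) :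
    IsSquare (descentMap e (some e 0 he) * descentMap e (some x y h) *
      descentMap e (some e 0 he + some x y h)) := by
  have hd : e - x ≠ 0 := sub_ne_zero.mpr hx.symm
  have key : (W.addX e x (W.slope e x 0 y) - e) * (x - e) = 3 * e ^ 2 + 2 * W.a₂ * e + W.a₄ := by
    rw [slope_of_X_ne hx.symm]
    obtain ⟨ℓ, hℓ⟩ : ∃ ℓ, ℓ = (0 - y) / (e - x) := ⟨_, rfl⟩
    rw [← hℓ]
    rw [eq_div_iff hd] at hℓ
    have h1 := (equation_iff _ _).mp h.1
    have h2 := (equation_iff _ _).mp he.1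
    simp at h1 h2
    simp only [addX, a₁_of_isCharNeTwoNF, zero_mul, add_zero]
    apply mul_right_cancel₀ hd
    linear_combination -(ℓ * (e - x) + (0 - y)) * hℓ - h1 + h2
  have hne : W.addX e x (W.slope e x 0 y) ≠ e := by
    intro h0
    rw [h0, sub_self, zero_mul] at key
    exact descentMap_ne_zero he (some e 0 he) (by rw [descentMap_some_self, ← key])
  rw [add_of_X_ne hx.symm, descentMap_some_of_ne _ hne, descentMap_some_of_ne _ hx,
    descentMap_some_self]
  exact ⟨3 * e ^ 2 + 2 * W.a₂ * e + W.a₄, by rw [mul_assoc, mul_comm (x - e), key]⟩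

/-- The component of the descent map at a root is a homomorphism modulo squares. -/
theorem isSquare_descentMap_mul {e : F} (he : W.Nonsingular e 0) (P Q : W.Point) :
    IsSquare (descentMap e P * descentMap e Q * descentMap e (P + Q)) := by
  by_cases hPQ : P + Q = 0
  · rw [eq_neg_of_add_eq_zero_left hPQ, neg_add_cancel, descentMap_neg, descentMap_zero, mul_one]
    exact ⟨_, rfl⟩
  match P, Q with
  | 0, Q => simp
  | some x y h, 0 => simp
  | some x y h, some x' y' h' =>
    by_cases hx : x = e
    · subst hx
      obtain rfl := y_eq_zero_of_x_eq he.1 h.1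
      refine isSquare_descentMap_mul_root he h' fun hx' ↦ hPQ ?_
      subst hx'
      obtain rfl := y_eq_zero_of_x_eq he.1 h'.1
      exact add_self_of_Y_eq (by simp [negY])
    by_cases hx' : x' = e
    · subst hx'
      obtain rfl := y_eq_zero_of_x_eq he.1 h'.1
      rw [mul_comm (descentMap x' _), add_comm]
      exact isSquare_descentMap_mul_root he h hx
    have hxy : ¬(x = x' ∧ y = W.negY x' y') := fun hxy ↦ hPQ (add_of_Y_eq hxy.1 hxy.2)
    have hadd := add_some hxy (h₁ := h) (h₂ := h')
    obtain ⟨ℓ, hℓ⟩ : ∃ ℓ, ℓ = W.slope x x' y y' := ⟨_, rfl⟩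
    by_cases hx'' : W.addX x x' (W.slope x x' y y') = e
    · have hT : some x y h + some x' y' h' = some e 0 he := by
        rw [hadd]
        have hn := nonsingular_add h h' hxy
        simp only [some.injEq]
        exact ⟨hx'', y_eq_zero_of_x_eq he.1 (hx'' ▸ hn.1)⟩
      -- If `P + Q = T`, then `Q = T + (-P)`, which reduces to translation by the root.
      have hsq := isSquare_descentMap_mul_root he ((nonsingular_neg x y).mpr h) hx
      rw [← neg_some h, ← hT, descentMap_neg, add_neg_cancel_comm] at hsq
      convert hsq using 1
      ring
    rw [hadd, descentMap_some_of_ne _ hx, descentMap_some_of_ne _ hx', descentMap_some_of_ne _ hx'']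
    -- For the line `L` through `P` and `Q`, `f - L²` is the monic cubic with roots `x`, `x'`,
    -- `x''`. At `e`, where `f` vanishes, this gives the square `L(e)²`.
    have hpoly := congrArg (Polynomial.eval e) (addPolynomial_slope h.1 h'.1 hxy)
    rw [addPolynomial_eq] at hpoly
    rw [← hℓ] at hpoly ⊢
    have h2 := (equation_iff _ _).mp he.1
    simp [Cubic.toPoly] at hpoly h2
    refine ⟨y + ℓ * (e - x), ?_⟩
    simp only [addX, a₁_of_isCharNeTwoNF, zero_mul, add_zero]
    linear_combination -hpoly + h2

/-- A point `(x, y)` on `y² = (x - e₁)(x - e₂)(x - e₃)` such that all `x - eᵢ` are squares is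
divisible by two. -/
theorem exists_add_self_eq_of_sq [W.IsElliptic] {e₁ e₂ e₃ x y r₁ r₂ r₃ : F} (h2 : (2 : F) ≠ 0)
    (h₁₂ : e₁ ≠ e₂) (h₁₃ : e₁ ≠ e₃) (h₂₃ : e₂ ≠ e₃)
    (ha₂ : W.a₂ = -(e₁ + e₂ + e₃)) (ha₄ : W.a₄ = e₁ * e₂ + e₁ * e₃ + e₂ * e₃)
    (ha₆ : W.a₆ = -(e₁ * e₂ * e₃)) (h : W.Nonsingular x y)
    (h₁ : x - e₁ = r₁ ^ 2) (h₂ : x - e₂ = r₂ ^ 2) (h₃ : x - e₃ = r₃ ^ 2)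
    (hy : y = r₁ * r₂ * r₃) : ∃ Q : W.Point, Q + Q = some x y h := by
  -- This point satisfies `x(Q) - e₁ = (r₁ + r₂)(r₁ + r₃)`, and similarly for the other roots; its
  -- tangent has slope `r₁ + r₂ + r₃`.
  have hQ : W.Equation (x + r₁ * r₂ + r₁ * r₃ + r₂ * r₃) ((r₁ + r₂) * (r₁ + r₃) * (r₂ + r₃)) := by
    rw [equation_iff, ha₂, ha₄, ha₆]
    simp
    obtain rfl : e₁ = x - r₁ ^ 2 := by linear_combination -h₁
    obtain rfl : e₂ = x - r₂ ^ 2 := by linear_combination -h₂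
    obtain rfl : e₃ = x - r₃ ^ 2 := by linear_combination -h₃
    ring
  have hn := equation_iff_nonsingular.mp hQ
  have hy0 : (r₁ + r₂) * (r₁ + r₃) * (r₂ + r₃) ≠ 0 := by
    refine mul_ne_zero (mul_ne_zero ?_ ?_) ?_ <;> intro h0
    · exact h₁₂ (by linear_combination -(r₁ - r₂) * h0 - h₁ + h₂)
    · exact h₁₃ (by linear_combination -(r₁ - r₃) * h0 - h₁ + h₃)
    · exact h₂₃ (by linear_combination -(r₂ - r₃) * h0 - h₂ + h₃)
  have hneg : (r₁ + r₂) * (r₁ + r₃) * (r₂ + r₃) ≠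
      W.negY (x + r₁ * r₂ + r₁ * r₃ + r₂ * r₃) ((r₁ + r₂) * (r₁ + r₃) * (r₂ + r₃)) := by
    simp only [negY, a₁_of_isCharNeTwoNF, a₃_of_isCharNeTwoNF, zero_mul, sub_zero]
    intro h0
    exact mul_ne_zero h2 hy0 (by linear_combination h0)
  refine ⟨some _ _ hn, ?_⟩
  have hsl : W.slope (x + r₁ * r₂ + r₁ * r₃ + r₂ * r₃) (x + r₁ * r₂ + r₁ * r₃ + r₂ * r₃)
      ((r₁ + r₂) * (r₁ + r₃) * (r₂ + r₃)) ((r₁ + r₂) * (r₁ + r₃) * (r₂ + r₃)) = r₁ + r₂ + r₃ := by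
    rw [slope_of_Y_ne rfl hneg, div_eq_iff (sub_ne_zero.mpr hneg)]
    simp only [negY, a₁_of_isCharNeTwoNF, a₃_of_isCharNeTwoNF, zero_mul, sub_zero, ha₂, ha₄]
    obtain rfl : e₁ = x - r₁ ^ 2 := by linear_combination -h₁
    obtain rfl : e₂ = x - r₂ ^ 2 := by linear_combination -h₂
    obtain rfl : e₃ = x - r₃ ^ 2 := by linear_combination -h₃
    ring
  rw [add_self_of_Y_ne hneg]
  simp only [some.injEq, hsl, addX, addY, negAddY, negY, a₁_of_isCharNeTwoNF,
    a₃_of_isCharNeTwoNF, ha₂]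
  refine ⟨by linear_combination -h₁ - h₂ - h₃, ?_⟩
  rw [hy]
  linear_combination (r₁ + r₂ + r₃) * (h₁ + h₂ + h₃)

/-- The kernel of the descent map consists of points divisible by two. -/
theorem exists_add_self_eq_of_isSquare_descentMap [W.IsElliptic] {e₁ e₂ e₃ : F} (h2 : (2 : F) ≠ 0)
    (h₁₂ : e₁ ≠ e₂) (h₁₃ : e₁ ≠ e₃) (h₂₃ : e₂ ≠ e₃)
    (ha₂ : W.a₂ = -(e₁ + e₂ + e₃)) (ha₄ : W.a₄ = e₁ * e₂ + e₁ * e₃ + e₂ * e₃)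
    (ha₆ : W.a₆ = -(e₁ * e₂ * e₃)) (P : W.Point) (hP₁ : IsSquare (descentMap e₁ P))
    (hP₂ : IsSquare (descentMap e₂ P)) : ∃ Q : W.Point, Q + Q = P := by
  cases P with
  | zero => exact ⟨0, add_zero _⟩
  | some x y h =>
    have hE : y ^ 2 = (x - e₁) * (x - e₂) * (x - e₃) := by
      have := (equation_iff _ _).mp h.1
      simp [ha₂, ha₄, ha₆] at this
      linear_combination this
    obtain ⟨⟨r₁, h₁⟩, ⟨r₂, h₂⟩, ⟨r₃, h₃⟩⟩ :
        IsSquare (x - e₁) ∧ IsSquare (x - e₂) ∧ IsSquare (x - e₃) := by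
      by_cases hx₁ : x = e₁
      · subst hx₁
        rw [descentMap_some_self] at hP₁
        rw [descentMap_some_of_ne _ h₁₂] at hP₂
        refine ⟨by simp, hP₂, ?_⟩
        have : x - e₃ = (3 * x ^ 2 + 2 * W.a₂ * x + W.a₄) / (x - e₂) := by
          rw [eq_div_iff (sub_ne_zero.mpr h₁₂), ha₂, ha₄]
          ring
        rw [this]
        exact hP₁.div hP₂
      by_cases hx₂ : x = e₂
      · subst hx₂
        rw [descentMap_some_self] at hP₂
        rw [descentMap_some_of_ne _ hx₁] at hP₁
        refine ⟨hP₁, by simp, ?_⟩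
        have : x - e₃ = (3 * x ^ 2 + 2 * W.a₂ * x + W.a₄) / (x - e₁) := by
          rw [eq_div_iff (sub_ne_zero.mpr hx₁), ha₂, ha₄]
          ring
        rw [this]
        exact hP₂.div hP₁
      rw [descentMap_some_of_ne _ hx₁] at hP₁
      rw [descentMap_some_of_ne _ hx₂] at hP₂
      refine ⟨hP₁, hP₂, ?_⟩
      have : x - e₃ = y ^ 2 / ((x - e₁) * (x - e₂)) := by
        rw [eq_div_iff (mul_ne_zero (sub_ne_zero.mpr hx₁) (sub_ne_zero.mpr hx₂)), hE]
        ring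
      rw [this]
      exact (IsSquare.sq y).div (hP₁.mul hP₂)
    rw [← sq] at h₁ h₂ h₃
    have hy : y ^ 2 = (r₁ * r₂ * r₃) ^ 2 := by rw [hE, h₁, h₂, h₃]; ring
    rcases sq_eq_sq_iff_eq_or_eq_neg.mp hy with hy | hy
    · exact exists_add_self_eq_of_sq h2 h₁₂ h₁₃ h₂₃ ha₂ ha₄ ha₆ h h₁ h₂ h₃ hy
    -- Only the squares of the `rᵢ` are given, so a wrong sign of `y` is absorbed in `r₁`.
    · exact exists_add_self_eq_of_sq h2 h₁₂ h₁₃ h₂₃ ha₂ ha₄ ha₆ h (r₁ := -r₁) (by rw [h₁, neg_sq])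
        h₂ h₃ (by rw [hy]; ring)

end WeierstrassCurve.Affine.Point

/-! ### Valuations and squares in `ℚ`. -/

theorem Nat.isSquare_of_even_factorization {n : ℕ} (hn : n ≠ 0)
    (h : ∀ p, p.Prime → Even (n.factorization p)) : IsSquare n := by
  rw [← Nat.prod_factorization_pow_eq_self hn]
  exact Finset.isSquare_prod _ fun p hp ↦ (h p (Nat.prime_of_mem_primeFactors hp)).isSquare_pow p

theorem Rat.isSquare_of_even_padicValRat {r : ℚ} (hr : 0 < r)
    (h : ∀ p : ℕ, p.Prime → Even (padicValRat p r)) : IsSquare r := by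
  have hnum : r.num.natAbs ≠ 0 := by simpa using hr.ne'
  have hsq : IsSquare (r.num.natAbs * r.den) := by
    refine Nat.isSquare_of_even_factorization (mul_ne_zero hnum r.den_ne_zero) fun p hp ↦ ?_
    have := h p hp
    rw [padicValRat_def, padicValInt, Int.even_sub, Int.even_coe_nat, Int.even_coe_nat] at this
    rw [Nat.factorization_mul hnum r.den_ne_zero, Finsupp.add_apply, Nat.factorization_def _ hp,
      Nat.factorization_def _ hp, Nat.even_add]
    exact this
  obtain ⟨m, hm⟩ := hsq
  have hd : (r.den : ℚ) ≠ 0 := by exact_mod_cast r.den_ne_zero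
  refine ⟨m / r.den, ?_⟩
  have hm' : (r.num : ℚ) * r.den = m * m := by
    have hm₁ : ((r.num.natAbs : ℤ) : ℚ) * r.den = m * m := by exact_mod_cast hm
    rwa [Int.natAbs_of_nonneg (Rat.num_pos.mpr hr).le] at hm₁
  rw [div_mul_div_comm, ← hm', mul_div_mul_right _ _ hd, Rat.num_div_den]

theorem padicValRat.eq_of_sub_of_neg {p : ℕ} [Fact p.Prime] {a b : ℚ} (ha : a ≠ 0) (hb : b ≠ 0)
    (hab : a ≠ b) (hv : padicValRat p (a - b) = 0) (hneg : padicValRat p a < 0) :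
    padicValRat p b = padicValRat p a := by
  have h := padicValRat.add_eq_of_lt (p := p) (q := a) (r := b - a) (by simpa using hb) ha
    (sub_ne_zero.mpr hab.symm) (by rwa [← neg_sub a b, padicValRat.neg, hv])
  rwa [add_sub_cancel] at h

theorem padicValRat.eq_zero_of_sub_of_pos {p : ℕ} [Fact p.Prime] {a b : ℚ} (ha : a ≠ 0)
    (hb : b ≠ 0) (hab : a ≠ b) (hv : padicValRat p (a - b) = 0) (hpos : 0 < padicValRat p a) :
    padicValRat p b = 0 := by
  have hv' : padicValRat p (b - a) = 0 := by rwa [← neg_sub a b, padicValRat.neg]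
  have h := padicValRat.add_eq_of_lt (p := p) (q := b - a) (r := a) (by simpa using hb)
    (sub_ne_zero.mpr hab.symm) ha (by rwa [hv'])
  rwa [sub_add_cancel, hv'] at h

/-- If `v(a) < 0`, all three factors have valuation `v(a)`, so `3v(a)` is even; if `v(a) > 0`, the
other two are units, so `v(a)` itself is even. -/
theorem padicValRat.even_of_mul_mul_eq_sq {p : ℕ} [Fact p.Prime] {a b c y : ℚ} (ha : a ≠ 0)
    (hb : b ≠ 0) (hc : c ≠ 0) (hab : a ≠ b) (hac : a ≠ c) (hvab : padicValRat p (a - b) = 0)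
    (hvac : padicValRat p (a - c) = 0) (h : a * b * c = y ^ 2) : Even (padicValRat p a) := by
  have hsum : padicValRat p a + padicValRat p b + padicValRat p c = 2 * padicValRat p y := by
    rw [← padicValRat.mul ha hb, ← padicValRat.mul (mul_ne_zero ha hb) hc, h, padicValRat.pow]
    norm_num
  rcases lt_trichotomy (padicValRat p a) 0 with hneg | h0 | hpos
  · rw [eq_of_sub_of_neg ha hb hab hvab hneg, eq_of_sub_of_neg ha hc hac hvac hneg] at hsum
    exact ⟨padicValRat p y - padicValRat p a, by linarith⟩
  · rw [h0]; exact Even.zero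
  · rw [eq_zero_of_sub_of_pos ha hb hab hvab hpos, eq_zero_of_sub_of_pos ha hc hac hvac hpos] at hsum
    exact ⟨padicValRat p y, by linarith⟩

theorem padicValRat.eq_zero_of_prime_ne {p q : ℕ} (hp : p.Prime) (hq : q.Prime) (h : p ≠ q) :
    padicValRat p q = 0 := by
  rw [padicValRat.of_nat]
  exact_mod_cast padicValNat.eq_zero_of_not_dvd fun hd ↦ h ((Nat.prime_dvd_prime_iff_eq hp hq).mp hd)

theorem even_padicValRat_of_isSquare_mul {ℓ : ℕ} [Fact ℓ.Prime] {a b c : ℚ} (ha : a ≠ 0)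
    (hb : b ≠ 0) (hc : c ≠ 0) (h : IsSquare (a * b * c))
    (hab : Even (padicValRat ℓ a) ↔ Even (padicValRat ℓ b)) : Even (padicValRat ℓ c) := by
  obtain ⟨s, hs⟩ := h
  have hs0 : s ≠ 0 := by
    rintro rfl
    exact mul_ne_zero (mul_ne_zero ha hb) hc (by rw [hs, mul_zero])
  have hv := congrArg (padicValRat ℓ) hs
  rw [padicValRat.mul (mul_ne_zero ha hb) hc, padicValRat.mul ha hb, padicValRat.mul hs0 hs0] at hv
  have he : Even (padicValRat ℓ a + padicValRat ℓ b + padicValRat ℓ c) := ⟨_, hv⟩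
  rw [Int.even_add, Int.even_add] at he
  tauto

/-! ### The descent on `E_p`. -/

namespace twinPrimeCurve

instance (p : ℕ) : (twinPrimeCurve p).IsCharNeTwoNF := ⟨rfl, rfl⟩

open WeierstrassCurve.Affine.Point

variable {p : ℕ}

theorem descentMap_cases (hp' : (p - 2).Prime)
    (P : (twinPrimeCurve p).toAffine.Point) :
    (descentMap 0 P = 1 ∧ descentMap 2 P = 1) ∨
    (descentMap 0 P = 2 * p ∧ descentMap 2 P = -2) ∨
    (descentMap 0 P = 2 ∧ descentMap 2 P = -(2 * (p - 2 : ℕ))) ∨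
    (descentMap 0 P = p ∧ descentMap 2 P = (p - 2 : ℕ)) ∨
    ∃ x y : ℚ, x ≠ 0 ∧ x ≠ 2 ∧ x ≠ p ∧ x * (x - 2) * (x - p) = y ^ 2 ∧
      descentMap 0 P = x ∧ descentMap 2 P = x - 2 := by
  have h2p : 2 < p := by have := hp'.two_le; omega
  have hq : ((p - 2 : ℕ) : ℚ) = p - 2 := by rw [Nat.cast_sub h2p.le]; norm_num
  have h2p' : (2 : ℚ) < p := by exact_mod_cast h2p
  rw [hq]
  cases P with
  | zero => exact .inl ⟨rfl, rfl⟩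
  | some x y h =>
    right
    have hE := (twinPrimeCurve_equation_iff p x y).mp h.1
    by_cases h0 : x = 0
    · subst h0
      left
      rw [descentMap_some_self, descentMap_some_of_ne _ (by norm_num)]
      simp [twinPrimeCurve]
    right
    by_cases h2 : x = 2
    · subst h2
      left
      rw [descentMap_some_self, descentMap_some_of_ne _ (by norm_num)]
      simp [twinPrimeCurve]
      ring
    right
    rw [descentMap_some_of_ne _ h0, descentMap_some_of_ne _ h2, sub_zero]
    by_cases h3 : x = p
    · exact .inl ⟨h3, by rw [h3]⟩
    · exact .inr ⟨x, y, h0, h2, h3, hE.symm, rfl, rfl⟩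

/-- A negative `x` would make `y²` a product of three negative factors. -/
theorem descentMap_zero_pos (hp : p.Prime) (hp' : (p - 2).Prime)
    (P : (twinPrimeCurve p).toAffine.Point) : 0 < descentMap 0 P := by
  have hp0 : (0 : ℚ) < p := by exact_mod_cast hp.pos
  rcases descentMap_cases hp' P with h | h | h | h | ⟨x, y, h0, -, -, hE, h, -⟩
  · rw [h.1]; norm_num
  · rw [h.1]; positivity
  · rw [h.1]; norm_num
  · rw [h.1]; exact hp0
  · rw [h]
    by_contra hx
    have hx : 0 < -x := by
      have := lt_of_le_of_ne (not_lt.mp hx) h0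
      linarith
    have : 0 < -x * (2 - x) * (p - x) := mul_pos (mul_pos hx (by linarith)) (by linarith)
    nlinarith [sq_nonneg y]

theorem even_padicValRat_descentMap_zero (hp : p.Prime) (hp' : (p - 2).Prime) {ℓ : ℕ}
    (hℓ : ℓ.Prime) (hℓ2 : ℓ ≠ 2) (hℓp : ℓ ≠ p) (P : (twinPrimeCurve p).toAffine.Point) :
    Even (padicValRat ℓ (descentMap 0 P)) := by
  have := Fact.mk hℓ
  have hp0 : (p : ℚ) ≠ 0 := by exact_mod_cast hp.ne_zero
  have hv2 : padicValRat ℓ (2 : ℚ) = 0 := padicValRat.eq_zero_of_prime_ne hℓ Nat.prime_two hℓ2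
  have hvp : padicValRat ℓ (p : ℚ) = 0 := padicValRat.eq_zero_of_prime_ne hℓ hp hℓp
  rcases descentMap_cases hp' P with h | h | h | h | ⟨x, y, h0, h2, h3, hE, h, -⟩
  · rw [h.1, padicValRat.one]; exact Even.zero
  · rw [h.1, padicValRat.mul two_ne_zero hp0, hv2, hvp]; exact Even.zero
  · rw [h.1, hv2]; exact Even.zero
  · rw [h.1, hvp]; exact Even.zero
  · rw [h]
    exact padicValRat.even_of_mul_mul_eq_sq h0 (sub_ne_zero.mpr h2) (sub_ne_zero.mpr h3)
      (sub_ne_zero.mp (by simp)) (sub_ne_zero.mp (by simpa using hp0)) (by simpa using hv2)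
      (by simpa using hvp) hE

theorem even_padicValRat_descentMap_two (hp' : (p - 2).Prime) {ℓ : ℕ}
    (hℓ : ℓ.Prime) (hℓ2 : ℓ ≠ 2) (hℓp : ℓ ≠ p - 2) (P : (twinPrimeCurve p).toAffine.Point) :
    Even (padicValRat ℓ (descentMap 2 P)) := by
  have := Fact.mk hℓ
  have hq0 : ((p - 2 : ℕ) : ℚ) ≠ 0 := by exact_mod_cast hp'.ne_zero
  have hq : ((p - 2 : ℕ) : ℚ) = p - 2 := by
    rw [Nat.cast_sub (by have := hp'.two_le; omega)]; norm_num
  have hv2 : padicValRat ℓ (2 : ℚ) = 0 := padicValRat.eq_zero_of_prime_ne hℓ Nat.prime_two hℓ2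
  have hvq : padicValRat ℓ ((p - 2 : ℕ) : ℚ) = 0 := padicValRat.eq_zero_of_prime_ne hℓ hp' hℓp
  rcases descentMap_cases hp' P with h | h | h | h | ⟨x, y, h0, h2, h3, hE, -, h⟩
  · rw [h.2, padicValRat.one]; exact Even.zero
  · rw [h.2, padicValRat.neg, hv2]; exact Even.zero
  · rw [h.2, padicValRat.neg, padicValRat.mul two_ne_zero hq0, hv2, hvq]; exact Even.zero
  · rw [h.2, hvq]; exact Even.zero
  · rw [h]
    have e₁ : x - 2 - x = -2 := by ring
    have e₂ : x - 2 - (x - p) = (p - 2 : ℕ) := by rw [hq]; ring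
    refine padicValRat.even_of_mul_mul_eq_sq (sub_ne_zero.mpr h2) h0 (sub_ne_zero.mpr h3)
      (sub_ne_zero.mp (e₁ ▸ by norm_num)) (sub_ne_zero.mp (e₂ ▸ hq0)) ?_ (e₂ ▸ hvq)
      (y := y) (by rw [← hE]; ring)
    rw [e₁, padicValRat.neg, hv2]

/-- Both `p` and `p - 2` are odd, so `x - p` has even 2-adic valuation, while the three factors
together have valuation `2v(y)`. -/
theorem even_padicValRat_two_descentMap_iff (hp : p.Prime) (hp' : (p - 2).Prime)
    (P : (twinPrimeCurve p).toAffine.Point) :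
    Even (padicValRat 2 (descentMap 0 P)) ↔ Even (padicValRat 2 (descentMap 2 P)) := by
  have hp0 : (p : ℚ) ≠ 0 := by exact_mod_cast hp.ne_zero
  have hq0 : ((p - 2 : ℕ) : ℚ) ≠ 0 := by exact_mod_cast hp'.ne_zero
  have h2p : p ≠ 2 := by rintro rfl; exact Nat.not_prime_zero hp'
  have h4p : p - 2 ≠ 2 := fun h4 ↦ by
    obtain rfl : p = 4 := by omega
    exact absurd hp (by norm_num)
  have hq : ((p - 2 : ℕ) : ℚ) = p - 2 := by
    rw [Nat.cast_sub (by have := hp'.two_le; omega)]; norm_num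
  have hvp : padicValRat 2 (p : ℚ) = 0 :=
    padicValRat.eq_zero_of_prime_ne Nat.prime_two hp h2p.symm
  have hvq : padicValRat 2 ((p - 2 : ℕ) : ℚ) = 0 :=
    padicValRat.eq_zero_of_prime_ne Nat.prime_two hp' h4p.symm
  rcases descentMap_cases hp' P with h | h | h | h | ⟨x, y, h0, h2, h3, hE, h, h'⟩
  · rw [h.1, h.2]
  · rw [h.1, h.2, padicValRat.neg, padicValRat.mul two_ne_zero hp0, hvp, add_zero]
  · rw [h.1, h.2, padicValRat.neg, padicValRat.mul two_ne_zero hq0, hvq, add_zero]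
  · rw [h.1, h.2, hvp, hvq]
  · rw [h, h']
    have h2' := sub_ne_zero.mpr h2
    have h3' := sub_ne_zero.mpr h3
    have e₁ : x - p - x = -p := by ring
    have e₂ : x - p - (x - 2) = -(p - 2 : ℕ) := by rw [hq]; ring
    have hev : Even (padicValRat 2 (x - p)) := by
      refine padicValRat.even_of_mul_mul_eq_sq h3' h0 h2'
        (sub_ne_zero.mp (e₁ ▸ neg_ne_zero.mpr hp0)) (sub_ne_zero.mp (e₂ ▸ neg_ne_zero.mpr hq0))
        ?_ ?_ (y := y) (by rw [← hE]; ring)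
      · rw [e₁, padicValRat.neg, hvp]
      · rw [e₂, padicValRat.neg, hvq]
    have hv := congrArg (padicValRat 2) hE
    rw [padicValRat.mul (mul_ne_zero h0 h2') h3', padicValRat.mul h0 h2', padicValRat.pow] at hv
    have he : Even (padicValRat 2 x + padicValRat 2 (x - 2) + padicValRat 2 (x - p)) := by
      rw [hv]; exact ⟨padicValRat 2 y, by push_cast; ring⟩
    rw [Int.even_add, Int.even_add] at he
    tauto

/-- The invariants of the image of a point under the descent map: the parities of the valuations
of `x` at `2` and `p` and of the valuation of `x - 2` at `p - 2`, and the sign of `x - 2`. -/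
noncomputable def descentClass (P : (twinPrimeCurve p).toAffine.Point) :
    Bool × Bool × Bool × Bool :=
  (decide (Even (padicValRat 2 (descentMap 0 P))), decide (Even (padicValRat p (descentMap 0 P))),
    decide (0 < descentMap 2 P), decide (Even (padicValRat (p - 2) (descentMap 2 P))))

theorem nonsingular_root (hp : p.Prime) (hp' : (p - 2).Prime) {e : ℚ}
    (he : e = 0 ∨ e = 2 ∨ e = p) : (twinPrimeCurve p).toAffine.Nonsingular e 0 := by
  have := twinPrimeCurve_isElliptic hp hp'
  refine equation_iff_nonsingular.mp ((twinPrimeCurve_equation_iff p e 0).mpr ?_)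
  rcases he with rfl | rfl | rfl <;> ring

/-- Equal invariants make both components at `P - Q` positive with even valuation at every prime,
hence squares. -/
theorem exists_add_self_eq_sub_of_descentClass_eq (hp : p.Prime) (hp' : (p - 2).Prime)
    {P Q : (twinPrimeCurve p).toAffine.Point} (h : descentClass P = descentClass Q) :
    ∃ R, R + R = P - Q := by
  have := twinPrimeCurve_isElliptic hp hp'
  have h2p : p ≠ 2 := by rintro rfl; exact Nat.not_prime_zero hp'
  simp only [descentClass, Prod.mk.injEq, decide_eq_decide] at h
  obtain ⟨hv2, hvp, hs, hvq⟩ := h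
  have hn₁ := nonsingular_root hp hp' (e := 0) (.inl rfl)
  have hn₂ := nonsingular_root hp hp' (e := 2) (.inr (.inl rfl))
  have hsq₁ := isSquare_descentMap_mul hn₁ P (-Q)
  have hsq₂ := isSquare_descentMap_mul hn₂ P (-Q)
  rw [descentMap_neg, ← sub_eq_add_neg] at hsq₁ hsq₂
  have hne₁ := descentMap_ne_zero hn₁
  have hne₂ := descentMap_ne_zero hn₂
  have heven₁ (ℓ : ℕ) (hℓ : ℓ.Prime) : Even (padicValRat ℓ (descentMap 0 (P - Q))) := by
    have := Fact.mk hℓ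
    by_cases h2 : ℓ = 2
    · subst h2
      exact even_padicValRat_of_isSquare_mul (hne₁ P) (hne₁ Q) (hne₁ _) hsq₁ hv2
    by_cases h3 : ℓ = p
    · subst h3
      exact even_padicValRat_of_isSquare_mul (hne₁ P) (hne₁ Q) (hne₁ _) hsq₁ hvp
    exact even_padicValRat_descentMap_zero hp hp' hℓ h2 h3 _
  have heven₂ (ℓ : ℕ) (hℓ : ℓ.Prime) : Even (padicValRat ℓ (descentMap 2 (P - Q))) := by
    have := Fact.mk hℓ
    by_cases h2 : ℓ = 2
    · subst h2
      exact (even_padicValRat_two_descentMap_iff hp hp' _).mp (heven₁ 2 hℓ)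
    by_cases h3 : ℓ = p - 2
    · subst h3
      exact even_padicValRat_of_isSquare_mul (hne₂ P) (hne₂ Q) (hne₂ _) hsq₂ hvq
    exact even_padicValRat_descentMap_two hp' hℓ h2 h3 _
  have hpos : 0 < descentMap 2 (P - Q) := by
    have hPQ : 0 < descentMap 2 P * descentMap 2 Q := by
      rcases (hne₂ P).lt_or_gt with hP | hP
      · refine mul_pos_of_neg_of_neg hP ((hne₂ Q).lt_or_gt.resolve_right fun hQ ↦ ?_)
        exact hP.not_gt (hs.mpr hQ)
      · exact mul_pos hP (hs.mp hP)
    exact (pos_iff_pos_of_mul_pos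
      (lt_of_le_of_ne hsq₂.nonneg (mul_ne_zero hPQ.ne' (hne₂ _)).symm)).mp hPQ
  exact exists_add_self_eq_of_isSquare_descentMap two_ne_zero (e₁ := (0 : ℚ)) (e₂ := 2)
    (e₃ := p)
    two_ne_zero.symm (by exact_mod_cast hp.ne_zero.symm) (by exact_mod_cast h2p.symm)
    (by simp [twinPrimeCurve]; ring) (by simp [twinPrimeCurve]) (by simp [twinPrimeCurve]) _
    (Rat.isSquare_of_even_padicValRat (descentMap_zero_pos hp hp' _) heven₁)
    (Rat.isSquare_of_even_padicValRat hpos heven₂)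

/-- Choosing representatives avoids having to show that `descentClass` is constant on cosets. -/
theorem exists_injective_quotient_range_two_nsmul (hp : p.Prime) (hp' : (p - 2).Prime) :
    ∃ f : (twinPrimeCurve p).toAffine.Point ⧸
      (nsmulAddMonoidHom (α := (twinPrimeCurve p).toAffine.Point) 2).range →
        Bool × Bool × Bool × Bool, Function.Injective f := by
  refine ⟨fun a ↦ descentClass a.out, fun a b hab ↦ ?_⟩
  obtain ⟨R, hR⟩ := exists_add_self_eq_sub_of_descentClass_eq hp hp' hab.symm
  rw [← QuotientAddGroup.out_eq' a, ← QuotientAddGroup.out_eq' b, QuotientAddGroup.eq]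
  exact ⟨R, by rw [nsmulAddMonoidHom_apply, two_nsmul, hR, sub_eq_neg_add]⟩

end twinPrimeCurve

open twinPrimeCurve WeierstrassCurve.Affine.Point

theorem proposition2p2p1 (p : ℕ) (hp : p.Prime) (hp' : (p - 2).Prime) :
    mordellWeilRank (twinPrimeCurve p) ≤ 2 := by
  have := twinPrimeCurve_isElliptic hp hp'
  obtain ⟨f, hf⟩ := exists_injective_quotient_range_two_nsmul hp hp'
  have := Finite.of_injective f hf
  have hfin : (nsmulAddMonoidHom (α := (twinPrimeCurve p).toAffine.Point) 2).range.FiniteIndex :=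
    AddSubgroup.finiteIndex_of_finite_quotient
  have hi : (nsmulAddMonoidHom (α := (twinPrimeCurve p).toAffine.Point) 2).range.index ≤ 16 := by
    simpa [AddSubgroup.index] using Nat.card_le_card_of_injective f hf
  have := fg_of_finiteIndex_range_two_nsmul _ hfin
  have hadd {e : ℚ} (he : (twinPrimeCurve p).toAffine.Nonsingular e 0) :
      Point.some e 0 he + Point.some e 0 he = 0 :=
    add_self_of_Y_eq (by simp [negY])
  have h2p : (2 : ℚ) ≠ p := by
    rintro h
    obtain rfl : 2 = p := by exact_mod_cast h
    exact Nat.not_prime_zero hp'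
  have hp0 : (0 : ℚ) ≠ p := by exact_mod_cast hp.ne_zero.symm
  -- The four 2-torsion points give `2 ^ r * 4 ≤ 16`.
  refine AddCommGroup.rank_le_two_of_index_le hfin.index_ne_zero hi
    ![0, .some 0 0 (nonsingular_root hp hp' (.inl rfl)),
      .some 2 0 (nonsingular_root hp hp' (.inr (.inl rfl))),
      .some p 0 (nonsingular_root hp hp' (.inr (.inr rfl)))] ?_ fun i ↦ ?_
  · intro i j hij
    fin_cases i <;> fin_cases j <;>
      simp_all [(Point.some_ne_zero _).symm, eq_comm]
  · fin_cases i <;> simp [hadd]
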